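/- A $3$-graph $G$ consists of a finite vertex set $V(G)$ and a set $E(G)$ of $3$-element subsets of $V(G)$. Its Lagrangian is $$\lambda(G)=\max\Big\{\sum_{e\in E(G)}\prod_{i\in e}x_i \;:\; x_i\ge 0 \text{ for } i\in V(G),\ \sum_{i\in V(G)}x_i=1\Big\}.$$ For a $3$-graph $F$, a $3$-graph $G$ is $F$-free if it contains no (not necessarily induced) subgraph isomorphic to $F$, and the Lagrangian density of $F$ is $$\pi_\lambda(F)=\sup\{3!\,\lambda(G): G \text{ is an } F\text{-free } 3\text{-graph}\}.$$ A $3$-graph $F$ with $t$ vertices is called perfect if $\pi_\lambda(F)=3!\,\lambda(K_{t-1}^3)$, where $K_{t-1}^3$ is the complete $3$-graph on $t-1$ vertices. Let $C_3^3$ be the $3$-uniform linear triangle, that is, the $3$-graph with vertex set $\{1,2,3,4,5,6\}$ and edges $\{1,2,3\},\{3,4,5\},\{5,6,1\}$. Then $$\pi_\lambda(C_3^3)=\frac{12}{25},$$ and $C_3^3$ is perfect, that is, $\pi_\lambda(C_3^3)=3!\,\lambda(K_5^3)$. -/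

import Mathlib

/-- An `r`-uniform hypergraph (`r`-graph) with vertex set `V`. -/
structure RGraph (r : ℕ) (V : Type*) where
  edges : Finset (Finset V)
  uniform : ∀ e ∈ edges, e.card = r

namespace RGraph

/-- The complete `r`-graph `K_t^r` on `t` vertices. -/
def complete (r t : ℕ) : RGraph r (Fin t) where
  edges := Finset.powersetCard r Finset.univ
  uniform := fun _ he => (Finset.mem_powersetCard.mp he).2

/-- The linear triangle `C_3^3 = {123, 345, 561}`, with vertices renamed `0, …, 5`. -/
def linearTriangle : RGraph 3 (Fin 6) where
  edges := {{0, 1, 2}, {2, 3, 4}, {4, 5, 0}}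
  uniform := by decide

/-- `G` contains an isomorphic copy of `F` as a (not necessarily induced) subgraph. -/
def Contains {r : ℕ} {V W : Type*} (G : RGraph r W) (F : RGraph r V) : Prop :=
  ∃ f : V ↪ W, ∀ e ∈ F.edges, e.map f ∈ G.edges

/-- `G` is `F`-free. -/
def Free {r : ℕ} {V W : Type*} (G : RGraph r W) (F : RGraph r V) : Prop :=
  ¬ G.Contains F

/-- The Lagrangian function `λ(G, x) = ∑_{e ∈ E(G)} ∏_{i ∈ e} x_i`. -/
def lagrangianFun {r : ℕ} {V : Type*} (G : RGraph r V) (x : V → ℝ) : ℝ :=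
  ∑ e ∈ G.edges, ∏ i ∈ e, x i

/-- The Lagrangian `λ(G)`: the maximum of `λ(G, x)` over the standard simplex
(it is attained when `V` is nonempty, see `isGreatest_lagrangian`; it is `0` when `V` is empty). -/
noncomputable def lagrangian {r : ℕ} {V : Type*} [Fintype V] (G : RGraph r V) : ℝ :=
  sSup (G.lagrangianFun '' stdSimplex ℝ V)

theorem isGreatest_lagrangian {r : ℕ} {V : Type*} [Fintype V] [Nonempty V] (G : RGraph r V) :
    IsGreatest (G.lagrangianFun '' stdSimplex ℝ V) G.lagrangian := by
  classical
  have hc : Continuous G.lagrangianFun := by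
    unfold lagrangianFun
    fun_prop
  refine ((isCompact_stdSimplex ℝ V).image hc).isGreatest_sSup ?_
  exact ⟨_, _, single_mem_stdSimplex ℝ (Classical.arbitrary V), rfl⟩

/-- The Lagrangian density `π_λ(F) = sup {r! λ(G) : G is an F-free r-graph}`, the supremum being
over all finite `r`-graphs, which up to isomorphism have vertex set `Fin n`. -/
noncomputable def lagrangianDensity {r : ℕ} {V : Type*} (F : RGraph r V) : ℝ :=
  sSup {a : ℝ | ∃ (n : ℕ) (G : RGraph r (Fin n)), G.Free F ∧ a = (r.factorial : ℝ) * G.lagrangian}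

/-- An `r`-graph `F` on `t` vertices is perfect if `π_λ(F) = r! λ(K_{t-1}^r)`. -/
def IsPerfect {r : ℕ} {V : Type*} [Fintype V] (F : RGraph r V) : Prop :=
  F.lagrangianDensity = (r.factorial : ℝ) * (complete r (Fintype.card V - 1)).lagrangian

end RGraph

/-! The value 12/25 is attained by `complete 3 5`, which has too few vertices to contain the
triangle. For the upper bound, `triForm` sums over ordered triples and so equals six times the
Lagrangian function. Take a maximiser on the simplex and suppose its value exceeds 12/25. By
induction on the number of vertices it has full support and no point with a zero coordinate does as
well, so every pair is covered (`CoversPairs.of_isMaxOn`) and every link form equals the maximum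
(`linkForm_eq_of_isMaxOn`).

On at most five vertices the bound is that of the complete 3-graph. On six or more, a pair of
maximum codegree is completed by every other vertex (`mem_of_max`). This rigidity leaves a vertex
whose link is a star, or two twin pairs with very restricted links (`exists_star_link_or_twins`). In
both cases the link forms involved cannot all exceed 12/25 (`not_forall_lt_linkForm`). -/

/-- A 3-graph encoded by its adjacency predicate on ordered triples. -/
structure IsTripleSystem {V : Type*} (T : V → V → V → Prop) : Prop where
  swap : ∀ {a b c}, T a b c → T b a c
  rotate : ∀ {a b c}, T a b c → T b c a
  ne : ∀ {a b c}, T a b c → a ≠ b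

/-- The triple system contains no linear triangle. -/
def LinearTriangleFree {V : Type*} (T : V → V → V → Prop) : Prop :=
  ∀ a b c d e f, T a b d → T b c e → T c a f →
    d = e ∨ e = f ∨ d = f ∨ d = c ∨ e = a ∨ f = b

/-- Every pair of distinct vertices lies in a triple. -/
def CoversPairs {V : Type*} (T : V → V → V → Prop) : Prop :=
  ∀ a b, a ≠ b → ∃ c, T a b c

/-! ### Structure of triangle-free systems covering pairs -/

namespace IsTripleSystem

variable {V : Type*} {T : V → V → V → Prop}

theorem swap_right (hT : IsTripleSystem T) {a b c : V} (h : T a b c) : T a c b :=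
  hT.swap (hT.rotate (hT.rotate h))

theorem ne_right (hT : IsTripleSystem T) {a b c : V} (h : T a b c) : b ≠ c :=
  hT.ne (hT.rotate h)

theorem ne_outer (hT : IsTripleSystem T) {a b c : V} (h : T a b c) : a ≠ c :=
  (hT.ne (hT.rotate (hT.rotate h))).symm

open Classical in
/-- The set of vertices completing a pair to a triple. -/
noncomputable def conbhd [Fintype V] (T : V → V → V → Prop) (a b : V) : Finset V :=
  Finset.univ.filter (T a b)

@[simp] theorem mem_conbhd [Fintype V] {a b c : V} : c ∈ conbhd T a b ↔ T a b c := by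
  simp [conbhd]

/-- The triples `uyp`, `yzc`, `zuv` form a linear triangle with corners `u`, `y`, `z` unless `c =
p`; the values `c = u` and `c = v` are excluded by `hu` and `hv`. Covering the pair `yz` then gives
the triple `ypz`. -/
theorem of_twin (hT : IsTripleSystem T) (hF : LinearTriangleFree T) (hC : CoversPairs T)
    {u v y p : V} (huy : T u y p) (hvy : T v y p)
    (hu : ∀ c, T u y c → c = v ∨ c = p) (hv : ∀ c, T v y c → c = u ∨ c = p)
    {z : V} (hz : T u v z) (hzy : z ≠ y) (hzp : z ≠ p) : T y p z ∧ ∀ c, T y z c → c = p := by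
  have key : ∀ c, T y z c → c = p := by
    intro c hc
    have h1 := hF u y z p c v huy hc (hT.rotate (hT.rotate hz))
    have := hT.ne huy
    have := hT.ne hvy
    have := hT.ne_outer hvy
    have := hT.ne_right hz
    have := hT.ne_outer hz
    have h2 : c = u → T u y z := fun h => hT.rotate (hT.rotate (h ▸ hc))
    have h3 : c = v → T v y z := fun h => hT.rotate (hT.rotate (h ▸ hc))
    grind
  obtain ⟨c, hc⟩ := hC y z (Ne.symm hzy)
  refine ⟨?_, key⟩
  have := key c hc
  subst this
  exact hT.swap_right hc

/-- By `of_twin`, the pair `yp` is completed by `u`, `v` and everything completing `uv` other than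
`y` and `p`. If `y` or `p` failed to complete `uv`, the codegree of `yp` would exceed the maximum.
-/
theorem twin_mem [Fintype V] (hT : IsTripleSystem T) (hF : LinearTriangleFree T) (hC : CoversPairs T)
    {u v y p : V} (huv : u ≠ v)
    (hmax : ∀ a b, a ≠ b → (conbhd T a b).card ≤ (conbhd T u v).card)
    (huy : T u y p) (hvy : T v y p)
    (hu : ∀ c, T u y c → c = v ∨ c = p) (hv : ∀ c, T v y c → c = u ∨ c = p) :
    T u v y ∧ T u v p := by
  classical
  have hsub : insert u (insert v (((conbhd T u v).erase y).erase p)) ⊆ conbhd T y p := by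
    intro z hz
    simp only [Finset.mem_insert, Finset.mem_erase, mem_conbhd] at hz ⊢
    rcases hz with rfl | rfl | ⟨h1, h2, h3⟩
    · exact hT.rotate huy
    · exact hT.rotate hvy
    · exact (hT.of_twin hF hC huy hvy hu hv h3 h2 h1).1
  have hcard := (Finset.card_le_card hsub).trans (hmax y p (hT.ne_right huy))
  have hvn : v ∉ ((conbhd T u v).erase y).erase p := by
    simp only [Finset.mem_erase, mem_conbhd]
    rintro ⟨_, _, h⟩
    exact hT.ne_right h rfl
  have hun : u ∉ insert v (((conbhd T u v).erase y).erase p) := by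
    simp only [Finset.mem_insert, Finset.mem_erase, mem_conbhd]
    rintro (h | ⟨_, _, h⟩)
    · exact huv h
    · exact hT.ne_outer h rfl
  rw [Finset.card_insert_of_notMem hun, Finset.card_insert_of_notMem hvn] at hcard
  constructor
  · by_contra h
    rw [Finset.erase_eq_of_notMem (a := y) (by simpa using h)] at hcard
    have := Finset.pred_card_le_card_erase (s := conbhd T u v) (a := p)
    omega
  · by_contra h
    rw [Finset.erase_eq_of_notMem (a := p) (by simp [h])] at hcard
    have := Finset.pred_card_le_card_erase (s := conbhd T u v) (a := y)
    omega

/-- In a linear-triangle-free triple system covering pairs, a pair of maximum codegree is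
completed to a triple by every other vertex. -/
theorem mem_of_max [Fintype V] (hT : IsTripleSystem T) (hF : LinearTriangleFree T) (hC : CoversPairs T)
    (hV : 6 ≤ Fintype.card V) {u v : V} (huv : u ≠ v)
    (hmax : ∀ a b, a ≠ b → (conbhd T a b).card ≤ (conbhd T u v).card)
    {z : V} (hzu : z ≠ u) (hzv : z ≠ v) : T u v z := by
  classical
  by_contra hz
  have nt : ∀ {z p : V}, ¬ T u v z → T u z p → T v z p →
      (∀ c, T u z c → c = p) → (∀ c, T v z c → c = p) → False :=
    fun h h1 h2 h3 h4 => h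
      (hT.twin_mem hF hC huv hmax h1 h2 (fun c hc => .inr (h3 c hc)) (fun c hc => .inr (h4 c hc))).1
  -- Three distinct completions of the sides of `u`, `v`, `z` would give a linear triangle.
  have sdr : ∀ {z p q w : V}, T u z p → T v z q → T u v w → ¬ T u v z →
      p = q ∨ w = p ∨ w = q := by
    intro z p q w hp hq hw hz
    have := hF u v z w q p hw hq (hT.swap hp)
    have h1 : p = v → T u v z := by rintro rfl; exact hT.swap_right hp
    have h2 : q = u → T u v z := by rintro rfl; exact hT.rotate (hT.rotate hq)
    grind
  -- Otherwise `uz` and `vz` have one common completion and no other, which `nt` forbids.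
  have pick : ∀ {z : V}, z ≠ u → z ≠ v → ¬ T u v z →
      ∃ p q, p ≠ q ∧ T u z p ∧ T v z q ∧ ∀ w, T u v w → w = p ∨ w = q := by
    intro z hzu hzv hz
    obtain ⟨p₀, hp₀⟩ := hC u z hzu.symm
    obtain ⟨q₀, hq₀⟩ := hC v z hzv.symm
    by_contra! hcon
    have heq : ∀ p q, T u z p → T v z q → p = q := by
      intro p q hp hq
      by_contra hpq
      obtain ⟨w, hw, h1, h2⟩ := hcon p q hpq hp hq
      rcases sdr hp hq hw hz with h | h | h <;> contradiction
    have h0 : p₀ = q₀ := heq _ _ hp₀ hq₀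
    subst h0
    exact nt hz hp₀ hq₀ (fun c hc => heq c _ hc hq₀) (fun c hc => (heq _ c hp₀ hc).symm)
  have card3 : ∀ {a b c d e : V}, T a b c → T a b d → T a b e → c ≠ d → c ≠ e → d ≠ e →
      3 ≤ (conbhd T a b).card := by
    intro a b c d e hc hd he h1 h2 h3
    rw [← Finset.card_eq_three.mpr ⟨c, d, e, h1, h2, h3, rfl⟩]
    apply Finset.card_le_card
    intro x
    simp only [Finset.mem_insert, Finset.mem_singleton, mem_conbhd]
    rintro (rfl | rfl | rfl) <;> assumption
  obtain ⟨p, q, hpq, hp, hq, hW⟩ := pick hzu hzv hz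
  have hup : u ≠ p := hT.ne_outer hp
  have hvq : v ≠ q := hT.ne_outer hq
  have hWsub : conbhd T u v ⊆ {p, q} := by
    intro w hw
    simpa using hW w (by simpa using hw)
  have hle2 : (conbhd T u v).card ≤ 2 := (Finset.card_le_card hWsub).trans Finset.card_le_two
  have hge2 : 2 ≤ (conbhd T u v).card := by
    obtain ⟨w, hw⟩ := hC u v huv
    rcases hW w hw with rfl | rfl
    · refine le_trans ?_ (hmax u w hup)
      rw [← Finset.card_pair hzv]
      apply Finset.card_le_card
      intro x
      simp only [Finset.mem_insert, Finset.mem_singleton, mem_conbhd]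
      rintro (rfl | rfl)
      · exact hT.swap_right hp
      · exact hT.swap_right hw
    · refine le_trans ?_ (hmax v w hvq)
      rw [← Finset.card_pair hzu]
      apply Finset.card_le_card
      intro x
      simp only [Finset.mem_insert, Finset.mem_singleton, mem_conbhd]
      rintro (rfl | rfl)
      · exact hT.swap_right hq
      · exact hT.rotate hw
  have hWeq : conbhd T u v = {p, q} :=
    Finset.eq_of_subset_of_card_le hWsub (by rw [Finset.card_pair hpq]; exact hge2)
  have huvp : T u v p := by rw [← mem_conbhd (T := T), hWeq]; simp
  have huvq : T u v q := by rw [← mem_conbhd (T := T), hWeq]; simp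
  -- The codegree of `uv` is now exactly 2, and a sixth vertex also fails to complete `uv`.
  obtain ⟨z', hz'⟩ : ∃ z', z' ∉ ({u, v, p, q, z} : Finset V) := by
    by_contra! h
    have h5 : ({u, v, p, q, z} : Finset V).card ≤ 5 := Finset.card_le_five
    have : Finset.univ ⊆ ({u, v, p, q, z} : Finset V) := fun x _ => h x
    have := Finset.card_le_card this
    rw [Finset.card_univ] at this
    omega
  simp only [Finset.mem_insert, Finset.mem_singleton, not_or] at hz'
  obtain ⟨hz'u, hz'v, hz'p, hz'q, hz'z⟩ := hz'
  have hz'W : ¬ T u v z' := by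
    intro h
    rcases hW _ h with h | h <;> contradiction
  obtain ⟨p', q', hpq', hp', hq', hW'⟩ := pick hz'u hz'v hz'W
  -- If `p' = p`, the pair `up` is completed by `z`, `v` and `z'`, exceeding codegree 2. So `z'`
  -- uses `p` and `q` in swapped roles.
  have hp'ne : p' ≠ p := by
    rintro rfl
    have := card3 (hT.swap_right hp) (hT.swap_right huvp) (hT.swap_right hp') hzv
      (Ne.symm hz'z) (Ne.symm hz'v)
    have := hmax u p' hup
    omega
  obtain ⟨rfl, rfl⟩ : p' = q ∧ q' = p := by
    have := hW' p huvp
    have := hW' q huvq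
    grind
  -- Any vertex `r` completing `zz'` yields a linear triangle: with corners `u`, `z`, `z'` in
  -- general, and with other corners when `r` is one of the two completions of `uv`.
  obtain ⟨r, hr⟩ := hC z z' (Ne.symm hz'z)
  have hru : r ≠ u := by
    rintro rfl
    have h1 := sdr (hT.rotate (hT.rotate hr)) hq huvp hz
    grind
  have h1 := hF u z z' q' r p' hp hr (hT.swap hp')
  have := hT.ne_right huvp
  have := hT.ne_right huvq
  clear nt sdr pick card3 hmax
  have h2 : r = q' → False := by
    rintro rfl
    have := hF z' u r p' v z (hT.swap hp') (hT.swap_right huvp) (hT.swap (hT.rotate hr))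
    grind
  have h3 : r = p' → False := by
    rintro rfl
    have := hF z u r q' v z' (hT.swap hp) (hT.swap_right huvq) (hT.rotate (hT.rotate hr))
    grind
  grind

/-- A linear-triangle-free triple system on at least six vertices which covers pairs has either a
vertex whose link is a star, or two pairs `{u, v}` and `{y, p}` such that every triple meeting
`{u, v, y, p}` contains one of the pairs. -/
theorem exists_star_link_or_twins [Fintype V] (hT : IsTripleSystem T) (hF : LinearTriangleFree T)
    (hC : CoversPairs T) (hV : 6 ≤ Fintype.card V) :
    (∃ a b, ∀ c d, T a c d → c = b ∨ d = b) ∨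
    ∃ u v y p, u ≠ v ∧ y ≠ p ∧ u ≠ y ∧ u ≠ p ∧ v ≠ y ∧ v ≠ p ∧
      (∀ c d, T u c d → c = v ∨ d = v ∨ (c = y ∧ d = p) ∨ (c = p ∧ d = y)) ∧
      (∀ c d, T v c d → c = u ∨ d = u ∨ (c = y ∧ d = p) ∨ (c = p ∧ d = y)) ∧
      (∀ c d, T y c d → c = p ∨ d = p ∨ (c = u ∧ d = v) ∨ (c = v ∧ d = u)) ∧
      (∀ c d, T p c d → c = y ∨ d = y ∨ (c = u ∧ d = v) ∨ (c = v ∧ d = u)) := by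
  classical
  obtain ⟨u, v, huv, hmax⟩ : ∃ u v : V, u ≠ v ∧
      ∀ a b, a ≠ b → (conbhd T a b).card ≤ (conbhd T u v).card := by
    have hne : ((Finset.univ : Finset (V × V)).filter fun e => e.1 ≠ e.2).Nonempty := by
      obtain ⟨a, b, hab⟩ := Fintype.exists_pair_of_one_lt_card (α := V) (by omega)
      exact ⟨(a, b), by simpa using hab⟩
    obtain ⟨⟨u, v⟩, h1, h2⟩ := Finset.exists_max_image _
      (fun e : V × V => (conbhd T e.1 e.2).card) hne
    exact ⟨u, v, by simpa using h1, fun a b hab => h2 (a, b) (by simpa using hab)⟩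
  have hfull : ∀ z, z ≠ u → z ≠ v → T u v z := fun z h1 h2 =>
    hT.mem_of_max hF hC hV huv hmax h1 h2
  -- Six vertices leave some `w` outside these five, and `uvw` is a triple, so it would close a
  -- linear triangle.
  have sdr : ∀ y p q, T u y p → T v y q → p = v ∨ q = u ∨ p = q := by
    intro y p q hp hq
    by_contra! hcon
    obtain ⟨w, hw⟩ : ∃ w, w ∉ ({u, v, y, p, q} : Finset V) := by
      by_contra! h
      have h5 : ({u, v, y, p, q} : Finset V).card ≤ 5 := Finset.card_le_five
      have : Finset.univ ⊆ ({u, v, y, p, q} : Finset V) := fun x _ => h x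
      have := Finset.card_le_card this
      rw [Finset.card_univ] at this
      omega
    simp only [Finset.mem_insert, Finset.mem_singleton, not_or] at hw
    have := hF u v y w q p (hfull w hw.1 hw.2.1) hq (hT.swap hp)
    grind
  by_cases hu : ∀ c d, T u c d → c = v ∨ d = v
  · exact .inl ⟨u, v, hu⟩
  by_cases hv : ∀ c d, T v c d → c = u ∨ d = u
  · exact .inl ⟨v, u, hv⟩
  right
  push Not at hu hv
  obtain ⟨y, p, hyp, hyv, hpv⟩ := hu
  obtain ⟨z, q, hzq, hzu, hqu⟩ := hv
  have hyu := hT.ne hyp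
  have hpu := hT.ne_outer hyp
  have hzv := hT.ne hzq
  have hqv := hT.ne_outer hzq
  have hyp' := hT.ne_right hyp
  have hzq' := hT.ne_right hzq
  -- Otherwise `{y, p}` and `{z, q}` are disjoint. A triple `yzr` then closes a triangle with `uyp`
  -- and `uvz` unless `r = p`, and with `vzq` and `uvy` unless `r = q`.
  have hvyp : T v y p := by
    have cross : ∀ c, T v y c → c = u ∨ c = p := fun c hc => by
      rcases sdr y p c hyp hc with h | h | h <;> grind
    have cross' : ∀ c, T v p c → c = u ∨ c = y := fun c hc => by
      rcases sdr p y c (hT.swap_right hyp) hc with h | h | h <;> grind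
    by_contra hcon
    have hzy : z ≠ y := by
      rintro rfl
      rcases cross q hzq with rfl | rfl <;> contradiction
    have hqy : q ≠ y := by
      rintro rfl
      rcases cross z (hT.swap_right hzq) with rfl | rfl
      · contradiction
      · exact hcon (hT.swap_right hzq)
    have hzp : z ≠ p := by
      rintro rfl
      rcases cross' q hzq with rfl | rfl <;> contradiction
    have hqp : q ≠ p := by
      rintro rfl
      rcases cross' z (hT.swap_right hzq) with rfl | rfl <;> contradiction
    obtain ⟨r, hr⟩ := hC y z hzy.symm
    have h1 := hF u y z p r v hyp hr (hT.rotate (hT.rotate (hfull z hzu hzv.symm)))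
    have h2 := hF v z y q r u hzq (hT.swap hr)
      (hT.swap (hT.rotate (hfull y hyu.symm hyv)))
    have h3 : r ≠ v := by
      rintro rfl
      rcases cross z (hT.rotate (hT.rotate hr)) with rfl | rfl <;> contradiction
    have h4 : r ≠ u := by
      rintro rfl
      have := sdr z y q (hT.swap_right (hT.rotate (hT.rotate hr))) hzq
      grind
    clear hmax hfull cross cross' sdr
    grind
  have huY : ∀ c, T u y c → c = v ∨ c = p := fun c hc => by
    rcases sdr y c p hc hvyp with h | h | h <;> grind
  have hvY : ∀ c, T v y c → c = u ∨ c = p := fun c hc => by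
    rcases sdr y p c hyp hc with h | h | h <;> grind
  have hpy := hT.swap_right hyp
  have hvpy := hT.swap_right hvyp
  have huP : ∀ c, T u p c → c = v ∨ c = y := fun c hc => by
    rcases sdr p c y hc hvpy with h | h | h <;> grind
  have hvP : ∀ c, T v p c → c = u ∨ c = y := fun c hc => by
    rcases sdr p y c hpy hc with h | h | h <;> grind
  have hYz : ∀ z, z ≠ u → z ≠ v → z ≠ y → z ≠ p → T y p z ∧ ∀ c, T y z c → c = p :=
    fun z h1 h2 h3 h4 => hT.of_twin hF hC hyp hvyp huY hvY (hfull z h1 h2) h3 h4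
  have hPz : ∀ z, z ≠ u → z ≠ v → z ≠ y → z ≠ p → T p y z ∧ ∀ c, T p z c → c = y :=
    fun z h1 h2 h3 h4 => hT.of_twin hF hC hpy hvpy huP hvP (hfull z h1 h2) h4 h3
  have hyuv : T y u v := hT.rotate (hT.rotate (hfull y hyu.symm hyv))
  refine ⟨u, v, y, p, huv, hyp', hyu, hpu, hyv.symm, hpv.symm, ?_, ?_, ?_, ?_⟩
  · intro c d hcd
    have := hT.ne hcd
    have := hT.ne_outer hcd
    have e1 : c = y → d = v ∨ d = p := by rintro rfl; exact huY d hcd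
    have e2 : c = p → d = v ∨ d = y := by rintro rfl; exact huP d hcd
    have e3 : d = y → c = v ∨ c = p := by rintro rfl; exact huY c (hT.swap_right hcd)
    have e4 : d = p → c = v ∨ c = y := by rintro rfl; exact huP c (hT.swap_right hcd)
    by_contra! hcon
    -- A triple `ucd` avoiding `v`, `y`, `p` forms a linear triangle with `yuv` and `ycp`.
    have hcyp := (hYz c (by grind) (by grind) (by grind) (by grind)).1
    have := hF y u c v d p hyuv hcd (hT.swap (hT.swap_right hcyp))
    clear hmax hfull sdr hYz hPz
    grind
  · intro c d hcd
    have := hT.ne hcd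
    have := hT.ne_outer hcd
    have e1 : c = y → d = u ∨ d = p := by rintro rfl; exact hvY d hcd
    have e2 : c = p → d = u ∨ d = y := by rintro rfl; exact hvP d hcd
    have e3 : d = y → c = u ∨ c = p := by rintro rfl; exact hvY c (hT.swap_right hcd)
    have e4 : d = p → c = u ∨ c = y := by rintro rfl; exact hvP c (hT.swap_right hcd)
    by_contra! hcon
    have hcyp := (hYz c (by grind) (by grind) (by grind) (by grind)).1
    have := hF y v c u d p (hT.swap_right hyuv) hcd (hT.swap (hT.swap_right hcyp))
    clear hmax hfull sdr hYz hPz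
    grind
  · intro c d hcd
    have := hT.ne hcd
    have e1 : c = u → d = v ∨ d = p := by rintro rfl; exact huY d (hT.swap hcd)
    have e2 : c = v → d = u ∨ d = p := by rintro rfl; exact hvY d (hT.swap hcd)
    by_contra! hcon
    have := (hYz c (by grind) (by grind) (by grind) (by grind)).2 d hcd
    exact hcon.2.1 this
  · intro c d hcd
    have := hT.ne hcd
    have e1 : c = u → d = v ∨ d = y := by rintro rfl; exact huP d (hT.swap hcd)
    have e2 : c = v → d = u ∨ d = y := by rintro rfl; exact hvP d (hT.swap hcd)
    by_contra! hcon
    have := (hPz c (by grind) (by grind) (by grind) (by grind)).2 d hcd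
    exact hcon.2.1 this

end IsTripleSystem

/-! ### The trilinear form and bounds on link forms -/

namespace IsTripleSystem

variable {V : Type*} {T : V → V → V → Prop}

open Classical in
/-- The indicator function of a triple system. -/
noncomputable def ind (T : V → V → V → Prop) (a b c : V) : ℝ := if T a b c then 1 else 0

theorem ind_of {a b c : V} (h : T a b c) : ind T a b c = 1 := if_pos h

theorem ind_of_not {a b c : V} (h : ¬ T a b c) : ind T a b c = 0 := if_neg h

theorem ind_nonneg (a b c : V) : 0 ≤ ind T a b c := by
  unfold ind; split_ifs <;> norm_num

theorem ind_swap (hT : IsTripleSystem T) (a b c : V) : ind T a b c = ind T b a c := by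
  classical exact if_congr ⟨hT.swap, hT.swap⟩ rfl rfl

theorem ind_rotate (hT : IsTripleSystem T) (a b c : V) : ind T a b c = ind T b c a := by
  classical exact if_congr ⟨hT.rotate, fun h => hT.rotate (hT.rotate h)⟩ rfl rfl

theorem ind_self_left (hT : IsTripleSystem T) (a c : V) : ind T a a c = 0 :=
  ind_of_not fun h => hT.ne h rfl

variable [Fintype V]

/-- The symmetric trilinear form of a triple system, summing over ordered triples. -/
noncomputable def triForm (T : V → V → V → Prop) (x y z : V → ℝ) : ℝ :=
  ∑ a, ∑ b, ∑ c, ind T a b c * (x a * y b * z c)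

/-- The quadratic form of the link of a vertex. -/
noncomputable def linkForm (T : V → V → V → Prop) (a : V) (x : V → ℝ) : ℝ :=
  ∑ b, ∑ c, ind T a b c * (x b * x c)

/-- The total weight of the vertices completing a pair to a triple. -/
noncomputable def codegForm (T : V → V → V → Prop) (a b : V) (x : V → ℝ) : ℝ :=
  ∑ c, ind T a b c * x c

theorem triForm_self (x : V → ℝ) : triForm T x x x = ∑ a, x a * linkForm T a x := by
  simp only [triForm, linkForm, Finset.mul_sum]
  refine Finset.sum_congr rfl fun a _ => Finset.sum_congr rfl fun b _ =>
    Finset.sum_congr rfl fun c _ => by ring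

theorem triForm_swap (hT : IsTripleSystem T) (x y z : V → ℝ) :
    triForm T x y z = triForm T y x z := by
  unfold triForm
  rw [Finset.sum_comm]
  refine Finset.sum_congr rfl fun a _ => Finset.sum_congr rfl fun b _ =>
    Finset.sum_congr rfl fun c _ => ?_
  rw [hT.ind_swap b a c]; ring

theorem triForm_rotate (hT : IsTripleSystem T) (x y z : V → ℝ) :
    triForm T x y z = triForm T y z x := by
  unfold triForm
  rw [Finset.sum_comm]
  refine Finset.sum_congr rfl fun a _ => ?_
  rw [Finset.sum_comm]
  refine Finset.sum_congr rfl fun b _ => Finset.sum_congr rfl fun c _ => ?_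
  rw [hT.ind_rotate c a b]; ring

theorem triForm_add_smul_left (x v y z : V → ℝ) (t : ℝ) :
    triForm T (x + t • v) y z = triForm T x y z + t * triForm T v y z := by
  simp only [triForm, Finset.mul_sum, ← Finset.sum_add_distrib, Pi.add_apply, Pi.smul_apply,
    smul_eq_mul]
  refine Finset.sum_congr rfl fun a _ => Finset.sum_congr rfl fun b _ =>
    Finset.sum_congr rfl fun c _ => by ring

theorem triForm_add_smul (hT : IsTripleSystem T) (x v : V → ℝ) (t : ℝ) :
    triForm T (x + t • v) (x + t • v) (x + t • v) =
      triForm T x x x + 3 * t * triForm T v x x + 3 * t ^ 2 * triForm T v v x +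
        t ^ 3 * triForm T v v v := by
  rw [triForm_add_smul_left, hT.triForm_rotate x, hT.triForm_rotate v, triForm_add_smul_left,
    triForm_add_smul_left, hT.triForm_rotate x _ x, hT.triForm_rotate x _ v,
    hT.triForm_rotate v _ x, hT.triForm_rotate v _ v, triForm_add_smul_left, triForm_add_smul_left,
    triForm_add_smul_left, triForm_add_smul_left, hT.triForm_rotate x x v,
    hT.triForm_swap v x v, hT.triForm_rotate x v v, hT.triForm_swap x v x]
  ring

theorem triForm_single_sub_single [DecidableEq V] (i j : V) (y z : V → ℝ) :
    triForm T (Pi.single i 1 - Pi.single j 1) y z =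
      ∑ b, ∑ c, (ind T i b c - ind T j b c) * (y b * z c) := by
  have h : ∀ a, (∑ b, ∑ c, ind T a b c *
      ((Pi.single i 1 - Pi.single j 1 : V → ℝ) a * y b * z c)) =
      (Pi.single i 1 - Pi.single j 1 : V → ℝ) a * ∑ b, ∑ c, ind T a b c * (y b * z c) := by
    intro a
    simp only [Finset.mul_sum]
    exact Finset.sum_congr rfl fun b _ => Finset.sum_congr rfl fun c _ => by ring
  simp only [triForm, h]
  simp only [Pi.sub_apply, sub_mul, Finset.sum_sub_distrib, Pi.single_apply, ite_mul, one_mul,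
    zero_mul, Finset.sum_ite_eq', Finset.mem_univ, if_true]

/-- No triple repeats a vertex, so the quadratic term keeps only the mixed `ij` contribution and the
cubic term vanishes. -/
theorem triForm_shift [DecidableEq V] (hT : IsTripleSystem T) (x : V → ℝ) (i j : V) (t : ℝ) :
    triForm T (x + t • (Pi.single i 1 - Pi.single j 1)) (x + t • (Pi.single i 1 - Pi.single j 1))
        (x + t • (Pi.single i 1 - Pi.single j 1)) =
      triForm T x x x + 3 * t * (linkForm T i x - linkForm T j x) -
        6 * t ^ 2 * codegForm T i j x := by
  have h1 : triForm T (Pi.single i 1 - Pi.single j 1) x x = linkForm T i x - linkForm T j x := by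
    rw [triForm_single_sub_single]
    simp only [linkForm, sub_mul, Finset.sum_sub_distrib]
  have h2 : ∀ z, triForm T (Pi.single i 1 - Pi.single j 1) (Pi.single i 1 - Pi.single j 1) z =
      -2 * codegForm T i j z := by
    intro z
    rw [triForm_single_sub_single, Finset.sum_comm]
    simp only [codegForm, Finset.mul_sum]
    refine Finset.sum_congr rfl fun c _ => ?_
    simp only [Pi.sub_apply, sub_mul, mul_sub, Finset.sum_sub_distrib, Pi.single_apply, ite_mul,
      one_mul, zero_mul, mul_ite, mul_zero, Finset.sum_ite_eq', Finset.mem_univ,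
      if_true, hT.ind_self_left, hT.ind_swap j i c]
    ring
  have h3 : codegForm T i j (Pi.single i 1 - Pi.single j 1) = 0 := by
    simp only [codegForm, Pi.sub_apply, mul_sub, Finset.sum_sub_distrib, Pi.single_apply, mul_ite,
      mul_one, mul_zero, Finset.sum_ite_eq', Finset.mem_univ, if_true]
    rw [hT.ind_rotate i j j, hT.ind_self_left, ← hT.ind_rotate i i j, hT.ind_self_left, sub_zero]
  rw [hT.triForm_add_smul, h1, h2, h2, h3]
  ring

/-- Dominating the adjacency of the link pointwise by symmetrised products of functions of one
vertex makes the double sum factor. -/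
theorem linkForm_le {x : V → ℝ} (hx : ∀ a, 0 ≤ x a) {a : V} (g h k l : V → ℝ)
    (hle : ∀ c d, ind T a c d ≤ g c * h d + h c * g d + k c * l d + l c * k d) :
    linkForm T a x ≤
      2 * (∑ c, g c * x c) * (∑ c, h c * x c) + 2 * (∑ c, k c * x c) * (∑ c, l c * x c) := by
  have key : ∀ p q : V → ℝ, (∑ c, p c * x c) * (∑ d, q d * x d) =
      ∑ c, ∑ d, p c * q d * (x c * x d) := by
    intro p q
    rw [Finset.sum_mul_sum]
    exact Finset.sum_congr rfl fun c _ => Finset.sum_congr rfl fun d _ => by ring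
  calc linkForm T a x
      ≤ ∑ c, ∑ d, (g c * h d + h c * g d + k c * l d + l c * k d) * (x c * x d) :=
        Finset.sum_le_sum fun c _ => Finset.sum_le_sum fun d _ =>
          mul_le_mul_of_nonneg_right (hle c d) (mul_nonneg (hx c) (hx d))
    _ = (∑ c, g c * x c) * (∑ d, h d * x d) + (∑ c, h c * x c) * (∑ d, g d * x d) +
        (∑ c, k c * x c) * (∑ d, l d * x d) + (∑ c, l c * x c) * (∑ d, k d * x d) := by
        simp only [key, add_mul, Finset.sum_add_distrib]
    _ = _ := by ring

theorem linkForm_le_sq {x : V → ℝ} (hT : IsTripleSystem T) (hx : x ∈ stdSimplex ℝ V) (a : V) :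
    linkForm T a x ≤ (1 - x a) ^ 2 := by
  classical
  refine (linkForm_le hx.1 (fun c => (1 - if c = a then 1 else 0) / 2)
    (fun c => 1 - if c = a then 1 else 0) 0 0 ?_).trans_eq ?_
  · intro c d
    by_cases h : T a c d
    · rw [ind_of h]
      have := hT.ne h
      have := hT.ne_outer h
      simp [this.symm, (hT.ne h).symm]
      norm_num
    · rw [ind_of_not h]
      simp only [Pi.zero_apply]
      split_ifs <;> norm_num
  · have : ∑ c, (1 - if c = a then (1 : ℝ) else 0) * x c = 1 - x a := by
      simp [sub_mul, Finset.sum_sub_distrib, hx.2]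
    simp only [div_mul_eq_mul_div, ← Finset.sum_div, this]
    simp
    ring

theorem linkForm_le_of_star {x : V → ℝ} (hT : IsTripleSystem T) (hx : x ∈ stdSimplex ℝ V)
    {a b : V} (hab : ∀ c d, T a c d → c = b ∨ d = b) : linkForm T a x ≤ 2 * x b * (1 - x b) := by
  classical
  refine (linkForm_le hx.1 (fun c => if c = b then 1 else 0)
    (fun c => 1 - if c = b then 1 else 0) 0 0 ?_).trans_eq ?_
  · intro c d
    by_cases h : T a c d
    · rw [ind_of h]
      have := hT.ne_right h
      rcases hab c d h with rfl | rfl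
      · simp [this.symm]
      · simp [this]
    · rw [ind_of_not h]
      simp only [Pi.zero_apply]
      split_ifs <;> norm_num
  · simp [sub_mul, Finset.sum_sub_distrib, hx.2]

theorem linkForm_le_of_twins {x : V → ℝ} (hT : IsTripleSystem T) (hx : x ∈ stdSimplex ℝ V)
    {u v y p : V} (huv : u ≠ v)
    (hu : ∀ c d, T u c d → c = v ∨ d = v ∨ (c = y ∧ d = p) ∨ (c = p ∧ d = y)) :
    linkForm T u x ≤ 2 * x v * (1 - x u - x v) + 2 * x y * x p := by
  classical
  refine (linkForm_le hx.1 (fun c => if c = v then 1 else 0)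
    (fun c => if c = u ∨ c = v then 0 else 1)
    (fun c => if c = y then 1 else 0) (fun c => if c = p then 1 else 0) ?_).trans_eq ?_
  · intro c d
    by_cases h : T u c d
    · rw [ind_of h]
      have h1 := (hT.ne h).symm
      have h2 := (hT.ne_outer h).symm
      have h3 := hT.ne_right h
      rcases hu c d h with rfl | rfl | ⟨rfl, rfl⟩ | ⟨rfl, rfl⟩
      all_goals
        simp [h1, h2, h3, h3.symm]
        try split_ifs <;> norm_num
    · rw [ind_of_not h]
      split_ifs <;> norm_num
  · have : ∀ c, (if c = u ∨ c = v then (0 : ℝ) else 1) * x c =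
        x c - (if c = u then x c else 0) - (if c = v then x c else 0) := by
      intro c
      by_cases h1 : c = u
      · subst h1; simp [huv]
      · by_cases h2 : c = v
        · subst h2; simp [huv.symm]
        · simp [h1, h2]
    simp only [this, Finset.sum_sub_distrib, hx.2]
    simp

theorem triForm_le_of_card_le_five {x : V → ℝ} (hT : IsTripleSystem T) (hx : x ∈ stdSimplex ℝ V)
    (hV : Fintype.card V ≤ 5) : triForm T x x x ≤ 12 / 25 := by
  classical
  -- The coefficient is the indicator of three distinct indices, by inclusion–exclusion.
  have hle : triForm T x x x ≤ ∑ a, ∑ b, ∑ c, (1 - (if a = b then 1 else 0) -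
      (if b = c then 1 else 0) - (if a = c then 1 else 0) +
      2 * (if a = b then (if b = c then 1 else 0) else 0)) * (x a * x b * x c) := by
    refine Finset.sum_le_sum fun a _ => Finset.sum_le_sum fun b _ => Finset.sum_le_sum fun c _ =>
      mul_le_mul_of_nonneg_right ?_ (mul_nonneg (mul_nonneg (hx.1 a) (hx.1 b)) (hx.1 c))
    by_cases h : T a b c
    · rw [ind_of h]
      simp [hT.ne h, hT.ne_right h, hT.ne_outer h]
    · rw [ind_of_not h]
      by_cases h1 : a = b
      · subst h1
        by_cases h2 : a = c <;> simp [h2]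
        norm_num
      · by_cases h2 : b = c
        · subst h2; simp [h1]
        · by_cases h3 : a = c
          · subst h3; simp [h1, h2]
          · simp [h1, h2, h3]
  have heq : (∑ a, ∑ b, ∑ c, (1 - (if a = b then 1 else 0) -
      (if b = c then 1 else 0) - (if a = c then 1 else 0) +
      2 * (if a = b then (if b = c then 1 else 0) else 0)) * (x a * x b * x c)) =
      1 + ∑ a, (2 * x a ^ 3 - 3 * x a ^ 2) := by
    have e0 : ∑ a, ∑ b, ∑ c, x a * x b * x c = 1 := by
      simp only [← Finset.mul_sum, hx.2, mul_one]
    simp only [add_mul, sub_mul, one_mul, Finset.sum_add_distrib, Finset.sum_sub_distrib, e0,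
      ite_mul, zero_mul, mul_ite, mul_one, mul_zero, Finset.sum_ite_eq, Finset.mem_univ, if_true]
    have e1 : ∑ a, ∑ b, (∑ c, if a = b then x a * x b * x c else 0) = ∑ a, x a ^ 2 := by
      refine Finset.sum_congr rfl fun a _ => ?_
      rw [Finset.sum_comm]
      simp [← Finset.mul_sum, hx.2, sq]
    have e2 : ∑ a, ∑ b, x a * x b * x b = ∑ a, x a ^ 2 := by
      rw [Finset.sum_comm]
      simp only [← Finset.sum_mul, hx.2, one_mul, sq]
    have e3 : ∑ a, ∑ b, x a * x b * x a = ∑ a, x a ^ 2 := by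
      simp only [← Finset.mul_sum, ← Finset.sum_mul, hx.2, mul_one, sq]
    have e4 : (∑ a, ∑ b, ∑ c, if a = b then if b = c then 2 * (x a * x b * x c) else 0 else 0) =
        ∑ a, 2 * x a ^ 3 := by
      refine Finset.sum_congr rfl fun a _ => ?_
      have : ∀ b, (∑ c, if a = b then if b = c then 2 * (x a * x b * x c) else 0 else 0) =
          if a = b then 2 * (x a * x b * x b) else 0 := by
        intro b; split_ifs <;> simp
      simp only [this, Finset.sum_ite_eq, Finset.mem_univ, if_true]
      ring
    simp only [e1, e2, e3, e4, ← Finset.mul_sum]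
    ring
  -- Tangent line at `1 / 5`; the gap is `2 (x a - 1/5)² (11/10 - x a)`.
  have hpt : ∀ a, 2 * x a ^ 3 - 3 * x a ^ 2 ≤ 11 / 125 - 24 / 25 * x a := by
    intro a
    have h1 : x a ≤ 1 := hx.2 ▸ Finset.single_le_sum (fun i _ => hx.1 i) (Finset.mem_univ a)
    nlinarith [mul_nonneg (sq_nonneg (x a - 1 / 5)) (by linarith : (0 : ℝ) ≤ 11 / 10 - x a)]
  have hsum : ∑ a, (2 * x a ^ 3 - 3 * x a ^ 2) ≤ ∑ a, (11 / 125 - 24 / 25 * x a) :=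
    Finset.sum_le_sum fun a _ => hpt a
  have hconst : ∑ a, (11 / 125 - 24 / 25 * x a) = Fintype.card V * (11 / 125) - 24 / 25 := by
    rw [Finset.sum_sub_distrib, ← Finset.mul_sum, hx.2, Finset.sum_const, Finset.card_univ,
      nsmul_eq_mul, mul_one]
  have : (Fintype.card V : ℝ) ≤ 5 := by exact_mod_cast hV
  linarith

end IsTripleSystem

/-! ### Optimality conditions and the Lagrangian bound -/

namespace IsTripleSystem

variable {V : Type*} {T : V → V → V → Prop}

theorem subtype (hT : IsTripleSystem T) (P : V → Prop) :
    IsTripleSystem fun a b c : {i // P i} => T a b c where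
  swap h := hT.swap h
  rotate h := hT.rotate h
  ne h e := hT.ne h (congrArg Subtype.val e)

theorem _root_.LinearTriangleFree.subtype (hF : LinearTriangleFree T) (P : V → Prop) :
    LinearTriangleFree fun a b c : {i // P i} => T a b c := by
  intro a b c d e f h1 h2 h3
  simp only [Subtype.ext_iff]
  exact hF a b c d e f h1 h2 h3

variable [Fintype V]

theorem continuous_triForm : Continuous fun x : V → ℝ => triForm T x x x := by
  unfold triForm
  fun_prop

theorem sum_subtype_ne [DecidableEq V] (j : V) (f : V → ℝ) (hf : f j = 0) :
    ∑ i : {i // i ≠ j}, f i = ∑ i, f i := by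
  rw [← Finset.sum_subtype (Finset.univ.erase j) (by simp) f, Finset.sum_erase _ hf]

theorem triForm_subtype_ne [DecidableEq V] (j : V) {x : V → ℝ} (hx : x j = 0) :
    triForm (fun a b c : {i // i ≠ j} => T a b c) (fun i => x i) (fun i => x i) (fun i => x i) =
      triForm T x x x := by
  unfold triForm
  rw [← sum_subtype_ne j _ (by simp [hx])]
  refine Finset.sum_congr rfl fun a _ => ?_
  rw [← sum_subtype_ne j _ (by simp [hx])]
  refine Finset.sum_congr rfl fun b _ => ?_
  rw [← sum_subtype_ne j _ (by simp [hx])]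
  rfl

theorem shift_mem_stdSimplex [DecidableEq V] {x : V → ℝ} (hx : x ∈ stdSimplex ℝ V) {i j : V}
    (hij : i ≠ j) {t : ℝ} (ht : 0 ≤ t) (htj : t ≤ x j) :
    x + t • (Pi.single i 1 - Pi.single j 1) ∈ stdSimplex ℝ V := by
  constructor
  · intro a
    have := hx.1 a
    by_cases ha : a = j
    · subst ha
      simp [hij.symm]
      linarith
    · by_cases hai : a = i
      · subst hai
        simp [hij]
        linarith
      · simp [ha, hai, this]
  · simp [Finset.sum_add_distrib, ← Finset.mul_sum, hx.2]

/-- At an interior maximiser of the form all link weights agree. -/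
theorem linkForm_le_of_isMaxOn (hT : IsTripleSystem T) {x : V → ℝ} (hx : x ∈ stdSimplex ℝ V)
    (hpos : ∀ a, 0 < x a) (hmax : IsMaxOn (fun x => triForm T x x x) (stdSimplex ℝ V) x)
    (i j : V) : linkForm T i x ≤ linkForm T j x := by
  classical
  by_contra! hlt
  have hij : i ≠ j := by rintro rfl; exact lt_irrefl _ hlt
  have hA : 0 ≤ codegForm T i j x :=
    Finset.sum_nonneg fun c _ => mul_nonneg (ind_nonneg _ _ _) (hx.1 c)
  set A := codegForm T i j x
  set D := linkForm T i x - linkForm T j x with hD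
  have hDpos : 0 < D := sub_pos.mpr hlt
  -- Shifting weight `t` from `j` to `i` gains `3t(D - 2tA)`. The first bound on `t` keeps the point
  -- in the simplex, the second keeps the gain positive.
  set t := min (x j) (D / (2 * (A + 1))) with ht
  have htpos : 0 < t := lt_min (hpos j) (by positivity)
  have h1 : t * (2 * (A + 1)) ≤ D := by
    rw [← le_div_iff₀ (by positivity)]
    exact min_le_right _ _
  have h2 := hmax (shift_mem_stdSimplex hx hij htpos.le (min_le_left _ _))
  simp only [Set.mem_ofPred_eq, hT.triForm_shift] at h2
  have h3 : 0 < t * (D - 2 * t * A) := mul_pos htpos (by nlinarith)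
  nlinarith

/-- If no triple contains `i` and `j`, the form is constant along the shift from `j` to `i`, so
emptying `j` gives another maximiser, with a zero coordinate. -/
theorem _root_.CoversPairs.of_isMaxOn (hT : IsTripleSystem T) {x : V → ℝ}
    (hx : x ∈ stdSimplex ℝ V) (hpos : ∀ a, 0 < x a)
    (hmax : IsMaxOn (fun x => triForm T x x x) (stdSimplex ℝ V) x)
    (hlt : ∀ y ∈ stdSimplex ℝ V, ∀ j, y j = 0 → triForm T y y y < triForm T x x x) :
    CoversPairs T := by
  classical
  intro i j hij
  by_contra! hcon
  have hA : codegForm T i j x = 0 :=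
    Finset.sum_eq_zero fun c _ => by rw [ind_of_not (hcon c), zero_mul]
  have hL : linkForm T i x = linkForm T j x :=
    le_antisymm (hT.linkForm_le_of_isMaxOn hx hpos hmax i j)
      (hT.linkForm_le_of_isMaxOn hx hpos hmax j i)
  have h := hlt _ (shift_mem_stdSimplex hx hij (hpos j).le le_rfl) j (by simp [hij.symm])
  rw [hT.triForm_shift, hA, hL] at h
  linarith

theorem linkForm_eq_of_isMaxOn (hT : IsTripleSystem T) {x : V → ℝ} (hx : x ∈ stdSimplex ℝ V)
    (hpos : ∀ a, 0 < x a) (hmax : IsMaxOn (fun x => triForm T x x x) (stdSimplex ℝ V) x)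
    (i : V) : linkForm T i x = triForm T x x x := by
  have : ∀ a, linkForm T a x = linkForm T i x := fun a =>
    le_antisymm (hT.linkForm_le_of_isMaxOn hx hpos hmax a i)
      (hT.linkForm_le_of_isMaxOn hx hpos hmax i a)
  simp only [triForm_self, this, ← Finset.sum_mul, hx.2, one_mul]

theorem not_forall_lt_linkForm (hT : IsTripleSystem T) (hF : LinearTriangleFree T)
    (hC : CoversPairs T) (hV : 6 ≤ Fintype.card V) {x : V → ℝ} (hx : x ∈ stdSimplex ℝ V) :
    ¬ ∀ a, 12 / 25 < linkForm T a x := by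
  intro hL
  rcases hT.exists_star_link_or_twins hF hC hV with
    ⟨a, b, hab⟩ | ⟨u, v, y, p, huv, hyp, huy, hup, hvy, hvp, hu, hv, hy, hp⟩
  · have h1 := hL a
    have h2 := hT.linkForm_le_of_star hx hab
    have h3 := hL b
    have h4 := hT.linkForm_le_sq hx b
    have h5 := hx.1 b
    have h6 : x b ≤ 1 := hx.2 ▸ Finset.single_le_sum (fun i _ => hx.1 i) (Finset.mem_univ b)
    -- At `x b = 2 / 5` the star bound equals 12/25. Beyond it, the link of `b` has form at most `(1
    -- - x b)² < 9 / 25`.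
    have h7 : 2 / 5 < x b := by nlinarith
    nlinarith
  · have hsum : x u + x v + (x y + x p) ≤ 1 := by
      classical
      have h := Finset.sum_le_univ_sum_of_nonneg (s := {u, v, y, p}) hx.1
      rw [hx.2, Finset.sum_insert (by simp [huv, huy, hup]), Finset.sum_insert (by simp [hvy, hvp]),
        Finset.sum_pair hyp] at h
      linarith
    -- Add the bounds for the two vertices of a twin pair and use `4cd ≤ (c + d)²`.
    have bound : ∀ s t a b c d : ℝ, s = a + b → t = c + d → 0 ≤ a → 0 ≤ b → 0 ≤ c → 0 ≤ d →
        s + t ≤ 1 → 12 / 25 < 2 * b * (1 - a - b) + 2 * c * d →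
        12 / 25 < 2 * a * (1 - b - a) + 2 * c * d →
        24 / 25 < 2 * s * (1 - s) + t ^ 2 := by
      intro s t a b c d hs ht _ _ _ _ _ h1 h2
      subst hs ht
      nlinarith [sq_nonneg (c - d)]
    have hs := bound _ _ _ _ _ _ rfl rfl (hx.1 u) (hx.1 v) (hx.1 y) (hx.1 p) hsum
      ((hL u).trans_le (hT.linkForm_le_of_twins hx huv hu))
      ((hL v).trans_le (hT.linkForm_le_of_twins hx huv.symm hv))
    have ht := bound _ _ _ _ _ _ rfl rfl (hx.1 y) (hx.1 p) (hx.1 u) (hx.1 v) (by linarith)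
      ((hL y).trans_le (hT.linkForm_le_of_twins hx hyp hy))
      ((hL p).trans_le (hT.linkForm_le_of_twins hx hyp.symm hp))
    have hs0 := add_nonneg (hx.1 u) (hx.1 v)
    have ht0 := add_nonneg (hx.1 y) (hx.1 p)
    generalize x u + x v = s at *
    generalize x y + x p = t at *
    -- From `t ≤ 1 - s`, the bound `hs` gives `24/25 < 1 - s²`. With `s` and `t` both below `1 / 5`,
    -- its right side is less than `9 / 25`.
    have hs2 : s < 1 / 5 := by nlinarith
    have ht2 : t < 1 / 5 := by nlinarith
    nlinarith

end IsTripleSystem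

/-- The Lagrangian bound for linear-triangle-free triple systems. -/
theorem LinearTriangleFree.triForm_le {V : Type*} [Fintype V] {T : V → V → V → Prop}
    (hT : IsTripleSystem T) (hF : LinearTriangleFree T) {x : V → ℝ} (hx : x ∈ stdSimplex ℝ V) :
    IsTripleSystem.triForm T x x x ≤ 12 / 25 := by
  classical
  induction hn : Fintype.card V using Nat.strong_induction_on generalizing V with
  | _ n ih =>
    obtain ⟨z, hz, hmax⟩ := (isCompact_stdSimplex ℝ V).exists_isMaxOn ⟨x, hx⟩
      (IsTripleSystem.continuous_triForm (T := T)).continuousOn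
    refine (hmax hx).trans ?_
    by_contra! hgt
    -- A zero coordinate allows its vertex to be deleted, so induction applies.
    have hzero : ∀ y ∈ stdSimplex ℝ V, ∀ j, y j = 0 → IsTripleSystem.triForm T y y y ≤ 12 / 25 := by
      intro y hy j hj
      rw [← IsTripleSystem.triForm_subtype_ne j hj]
      refine ih _ ?_ (hT.subtype _) (hF.subtype _) ⟨fun i => hy.1 i, ?_⟩ rfl
      · rw [← hn]
        exact Fintype.card_subtype_lt (x := j) (by simp)
      · rw [IsTripleSystem.sum_subtype_ne j y hj, hy.2]
    have hpos : ∀ a, 0 < z a := fun a =>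
      (hz.1 a).lt_of_ne fun h => (hzero z hz a h.symm).not_gt hgt
    have hC := CoversPairs.of_isMaxOn hT hz hpos hmax fun y hy j hj =>
      (hzero y hy j hj).trans_lt hgt
    rcases le_or_gt (Fintype.card V) 5 with h5 | h5
    · exact (hT.triForm_le_of_card_le_five hz h5).not_gt hgt
    · exact hT.not_forall_lt_linkForm hF hC h5 hz fun a => by
        rw [hT.linkForm_eq_of_isMaxOn hz hpos hmax]; exact hgt

/-! ### Transfer to 3-graphs and the extremal example -/

namespace RGraph

open IsTripleSystem

/-- The adjacency predicate of a 3-graph on ordered triples. -/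
def IsTriple {V : Type*} [DecidableEq V] (G : RGraph 3 V) (a b c : V) : Prop :=
  a ≠ b ∧ a ≠ c ∧ b ≠ c ∧ {a, b, c} ∈ G.edges

variable {V : Type*} [DecidableEq V] (G : RGraph 3 V)

theorem isTripleSystem_isTriple : IsTripleSystem G.IsTriple where
  swap := by
    rintro a b c ⟨h1, h2, h3, h4⟩
    exact ⟨h1.symm, h3, h2, by rwa [Finset.insert_comm]⟩
  rotate := by
    rintro a b c ⟨h1, h2, h3, h4⟩
    refine ⟨h3, h1.symm, h2.symm, ?_⟩
    rwa [Finset.pair_comm c a, Finset.insert_comm]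
  ne h := h.1

theorem linearTriangleFree_isTriple (hG : G.Free linearTriangle) :
    LinearTriangleFree G.IsTriple := by
  rintro a b c d e f ⟨hab, had, hbd, h1⟩ ⟨hbc, hbe, hce, h2⟩ ⟨hca, hcf, haf, h3⟩
  by_contra! hcon
  obtain ⟨hde, hef, hdf, hdc, hea, hfb⟩ := hcon
  -- The corners `a`, `b`, `c` take positions 0, 2, 4, the vertices of degree two in
  -- `linearTriangle`.
  refine hG ⟨⟨![a, d, b, e, c, f], ?_⟩, ?_⟩
  · intro i j hij
    fin_cases i <;> fin_cases j <;> simp_all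
  · intro s hs
    simp only [linearTriangle, Finset.mem_insert, Finset.mem_singleton] at hs
    rcases hs with rfl | rfl | rfl
    · rw [Finset.map_insert, Finset.map_insert, Finset.map_singleton]
      change ({a, d, b} : Finset V) ∈ G.edges
      rwa [Finset.pair_comm]
    · rw [Finset.map_insert, Finset.map_insert, Finset.map_singleton]
      change ({b, e, c} : Finset V) ∈ G.edges
      rwa [Finset.pair_comm]
    · rw [Finset.map_insert, Finset.map_insert, Finset.map_singleton]
      change ({c, f, a} : Finset V) ∈ G.edges
      rwa [Finset.pair_comm]

theorem sum_ordered_triples [Fintype V] {p q r : V} (hpq : p ≠ q) (hpr : p ≠ r) (hqr : q ≠ r)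
    (x : V → ℝ) :
    ∑ t : V × V × V with t.1 ≠ t.2.1 ∧ t.1 ≠ t.2.2 ∧ t.2.1 ≠ t.2.2 ∧
        ({t.1, t.2.1, t.2.2} : Finset V) = {p, q, r}, x t.1 * x t.2.1 * x t.2.2 =
      6 * (x p * x q * x r) := by
  have : (Finset.univ.filter fun t : V × V × V => t.1 ≠ t.2.1 ∧ t.1 ≠ t.2.2 ∧ t.2.1 ≠ t.2.2 ∧
      ({t.1, t.2.1, t.2.2} : Finset V) = {p, q, r}) =
      {(p, q, r), (p, r, q), (q, p, r), (q, r, p), (r, p, q), (r, q, p)} := by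
    ext ⟨a, b, c⟩
    simp only [Finset.mem_filter, Finset.mem_univ, true_and, Finset.mem_insert,
      Finset.mem_singleton, Prod.mk.injEq]
    constructor
    · rintro ⟨h1, h2, h3, h⟩
      have ha : a ∈ ({p, q, r} : Finset V) := h ▸ by simp
      have hb : b ∈ ({p, q, r} : Finset V) := h ▸ by simp
      have hc : c ∈ ({p, q, r} : Finset V) := h ▸ by simp
      simp only [Finset.mem_insert, Finset.mem_singleton] at ha hb hc
      clear h
      grind
    · rintro (⟨rfl, rfl, rfl⟩ | ⟨rfl, rfl, rfl⟩ | ⟨rfl, rfl, rfl⟩ | ⟨rfl, rfl, rfl⟩ |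
        ⟨rfl, rfl, rfl⟩ | ⟨rfl, rfl, rfl⟩) <;>
      refine ⟨by grind, by grind, by grind, ?_⟩ <;> ext <;> simp <;> tauto
  rw [this]
  repeat rw [Finset.sum_insert (by simp [hpq, hpr, hqr, hpq.symm, hpr.symm, hqr.symm])]
  rw [Finset.sum_singleton]
  ring

theorem triForm_isTriple [Fintype V] (x : V → ℝ) :
    triForm G.IsTriple x x x = 6 * G.lagrangianFun x := by
  have h1 : triForm G.IsTriple x x x =
      ∑ t : V × V × V with t.1 ≠ t.2.1 ∧ t.1 ≠ t.2.2 ∧ t.2.1 ≠ t.2.2 ∧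
        ({t.1, t.2.1, t.2.2} : Finset V) ∈ G.edges, x t.1 * x t.2.1 * x t.2.2 := by
    rw [Finset.sum_filter, Fintype.sum_prod_type]
    refine Finset.sum_congr rfl fun a _ => ?_
    rw [Fintype.sum_prod_type]
    refine Finset.sum_congr rfl fun b _ => Finset.sum_congr rfl fun c _ => ?_
    by_cases h : G.IsTriple a b c
    · rw [ind_of h, one_mul]
      exact (if_pos h).symm
    · rw [ind_of_not h, zero_mul]
      exact (if_neg h).symm
  rw [h1, lagrangianFun, Finset.mul_sum, ← Finset.sum_fiberwise_of_maps_to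
    (t := G.edges) (g := fun t : V × V × V => ({t.1, t.2.1, t.2.2} : Finset V))
    (by intro t ht; exact (Finset.mem_filter.mp ht).2.2.2.2)]
  refine Finset.sum_congr rfl fun e he => ?_
  obtain ⟨p, q, r, hpq, hpr, hqr, rfl⟩ := Finset.card_eq_three.mp (G.uniform e he)
  rw [Finset.prod_insert (by simp [hpq, hpr]), Finset.prod_pair hqr, ← mul_assoc (x p),
    ← sum_ordered_triples hpq hpr hqr x, Finset.filter_filter]
  refine Finset.sum_congr (Finset.filter_congr fun t _ => ?_) fun _ _ => rfl
  constructor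
  · rintro ⟨⟨h1, h2, h3, -⟩, h4⟩
    exact ⟨h1, h2, h3, h4⟩
  · rintro ⟨h1, h2, h3, h4⟩
    exact ⟨⟨h1, h2, h3, h4 ▸ he⟩, h4⟩

theorem lagrangian_le_of_free [Fintype V] (hG : G.Free linearTriangle) :
    G.lagrangian ≤ 2 / 25 := by
  -- Nonnegativity of the bound is needed for an empty vertex set, where the supremum is 0 by
  -- convention.
  refine Real.sSup_le ?_ (by norm_num)
  rintro _ ⟨x, hx, rfl⟩
  have h := (G.linearTriangleFree_isTriple hG).triForm_le G.isTripleSystem_isTriple hx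
  rw [triForm_isTriple] at h
  linarith

theorem complete_five_free : (complete 3 5).Free linearTriangle := by
  rintro ⟨f, -⟩
  simpa using Fintype.card_le_of_embedding f

theorem lagrangian_complete_five : (complete 3 5).lagrangian = 2 / 25 := by
  refine le_antisymm (lagrangian_le_of_free _ complete_five_free) ?_
  refine (isGreatest_lagrangian (complete 3 5)).2 ⟨fun _ => 1 / 5, ⟨fun _ => by norm_num, ?_⟩, ?_⟩
  · simp
  · have h : ∀ e ∈ (complete 3 5).edges, ∏ _i ∈ e, (1 / 5 : ℝ) = 1 / 125 := by
      intro e he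
      rw [Finset.prod_const, (complete 3 5).uniform e he]
      norm_num
    rw [lagrangianFun, Finset.sum_congr rfl h, Finset.sum_const, complete,
      Finset.card_powersetCard, Finset.card_univ, Fintype.card_fin, nsmul_eq_mul,
      show Nat.choose 5 3 = 10 from rfl]
    norm_num

theorem lagrangianDensity_linearTriangle : linearTriangle.lagrangianDensity = 12 / 25 := by
  refine IsGreatest.csSup_eq ⟨⟨5, complete 3 5, complete_five_free, ?_⟩, ?_⟩
  · rw [lagrangian_complete_five, show Nat.factorial 3 = 6 from rfl]
    norm_num
  · rintro _ ⟨n, G, hG, rfl⟩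
    have := G.lagrangian_le_of_free hG
    rw [show Nat.factorial 3 = 6 from rfl]
    push_cast
    linarith

end RGraph

theorem corollary1p7 :
    RGraph.linearTriangle.lagrangianDensity = 12 / 25 ∧ RGraph.linearTriangle.IsPerfect := by
  refine ⟨RGraph.lagrangianDensity_linearTriangle, ?_⟩
  rw [RGraph.IsPerfect, RGraph.lagrangianDensity_linearTriangle, Fintype.card_fin,
    RGraph.lagrangian_complete_five, show Nat.factorial 3 = 6 from rfl]
  norm_num
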